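/- A modal algebra is a Boolean algebra $B$ with an operator $\Diamond:B\to B$ satisfying $\Diamond(a\vee b)=\Diamond a\vee\Diamond b$ and $\Diamond\bot=\bot$. Let $\mathbf{MA}$ be the category of modal algebras and Boolean morphisms preserving $\Diamond$, and $\mathbf{MA}_f$ its full subcategory of finite modal algebras. Let $\mathbf{CAMA}_\infty$ be the category of modal algebras whose Boolean algebra is complete and atomic and whose $\Diamond$ preserves arbitrary joins, with morphisms the Boolean morphisms preserving $\Diamond$ and arbitrary joins and meets. Let $\mathrm{Pro}\,\mathbf{MA}_f=(\mathrm{Ind}(\mathbf{MA}_f^{op}))^{op}$ be the category of profinite modal algebras, where $\mathrm{Ind}(\mathcal C)$ is the full subcategory of $\mathbf{Set}^{\mathcal C^{op}}$ on the small filtered colimits of representable functors. A pro-object $P$, a formal cofiltered limit of finite modal algebras, is regarded as an object of $\mathbf{CAMA}_\infty$ by forming the actual limit, namely the limit of the finite modal algebras $A$ over all morphisms $P\to A$ in $\mathrm{Pro}\,\mathbf{MA}_f$, with componentwise operations. **Theorem.** The resulting functor $\mathrm{Pro}\,\mathbf{MA}_f\hookrightarrow\mathbf{CAMA}_\infty$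 is full and faithful, and the inclusion functor $\iota:\mathrm{Pro}\,\mathbf{MA}_f\hookrightarrow\mathbf{CAMA}_\infty\hookrightarrow\mathbf{MA}$ (the composite of it with the non-full inclusion $\mathbf{CAMA}_\infty\hookrightarrow\mathbf{MA}$) has a left adjoint $\mathrm{PrC}:\mathbf{MA}\to\mathrm{Pro}\,\mathbf{MA}_f$, the profinite completion functor. -/

import Mathlib

open CategoryTheory CategoryTheory.Limits Opposite

universe u w

/-! ### Modal algebras -/

/-- A modal algebra: a Boolean algebra with a finite-join preserving operator `◇`. -/
class ModalAlgebra (α : Type u) extends BooleanAlgebra α where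
  /-- The possibility operator. -/
  dia : α → α
  dia_sup : ∀ a b : α, dia (a ⊔ b) = dia a ⊔ dia b
  dia_bot : dia ⊥ = ⊥

/-- A complete atomic modal algebra whose possibility operator preserves arbitrary joins. -/
class CompleteModalAlgebra (α : Type u) extends
    CompleteAtomicBooleanAlgebra α, ModalAlgebra α where
  dia_sSup : ∀ s : Set α, dia (sSup s) = sSup (dia '' s)

/-- Boolean morphisms preserving `◇`. -/
@[ext]
structure ModalHom (α β : Type u) [ModalAlgebra α] [ModalAlgebra β] extends
    BoundedLatticeHom α β where
  map_dia' : ∀ a : α, toFun (ModalAlgebra.dia a) = ModalAlgebra.dia (toFun a)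

/-- Boolean morphisms preserving `◇` as well as arbitrary joins and meets. -/
@[ext]
structure CompleteModalHom (α β : Type u) [CompleteModalAlgebra α] [CompleteModalAlgebra β]
    extends CompleteLatticeHom α β where
  map_dia' : ∀ a : α, toFun (ModalAlgebra.dia a) = ModalAlgebra.dia (toFun a)

instance ModalHom.instFunLike {α β : Type u} [ModalAlgebra α] [ModalAlgebra β] :
    FunLike (ModalHom α β) α β where
  coe f := f.toFun
  coe_injective _ _ h := ModalHom.ext h

instance ModalHom.instBoundedLatticeHomClass {α β : Type u} [ModalAlgebra α] [ModalAlgebra β] :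
    BoundedLatticeHomClass (ModalHom α β) α β where
  map_sup f := f.map_sup'
  map_inf f := f.map_inf'
  map_top f := f.map_top'
  map_bot f := f.map_bot'

instance CompleteModalHom.instFunLike {α β : Type u} [CompleteModalAlgebra α]
    [CompleteModalAlgebra β] : FunLike (CompleteModalHom α β) α β where
  coe f := f.toFun
  coe_injective _ _ h := CompleteModalHom.ext h

/-- The category `MA` of modal algebras. -/
structure MA where
  /-- The underlying type. -/
  carrier : Type u
  [str : ModalAlgebra carrier]

attribute [instance] MA.str

instance : CoeSort MA.{u} (Type u) := ⟨MA.carrier⟩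

instance MA.instCategory : Category.{u} MA.{u} where
  Hom A B := ModalHom A B
  id A := { BoundedLatticeHom.id A with map_dia' := fun _ => rfl }
  comp f g :=
    { g.toBoundedLatticeHom.comp f.toBoundedLatticeHom with
      map_dia' := fun a => (congrArg g (f.map_dia' a)).trans (g.map_dia' (f a)) }

instance MA.instConcreteCategory : ConcreteCategory MA.{u} (fun A B => ModalHom A B) where
  hom f := f
  ofHom f := f

/-- The category `CAMA∞` of complete atomic, completely additive modal algebras. -/
structure CAMA where
  /-- The underlying type. -/
  carrier : Type u
  [str : CompleteModalAlgebra carrier]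

attribute [instance] CAMA.str

instance : CoeSort CAMA.{u} (Type u) := ⟨CAMA.carrier⟩

instance CAMA.instCategory : Category.{u} CAMA.{u} where
  Hom A B := CompleteModalHom A B
  id A := { CompleteLatticeHom.id A with map_dia' := fun _ => rfl }
  comp f g :=
    { g.toCompleteLatticeHom.comp f.toCompleteLatticeHom with
      map_dia' := fun a => (congrArg g (f.map_dia' a)).trans (g.map_dia' (f a)) }

instance CAMA.instConcreteCategory :
    ConcreteCategory CAMA.{u} (fun A B => CompleteModalHom A B) where
  hom f := f
  ofHom f := f

/-- The inclusion `CAMA∞ ↪ MA`. -/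
def CAMA.toMA : CAMA.{u} ⥤ MA.{u} where
  obj A := ⟨A⟩
  map f := ({ f.toCompleteLatticeHom with
    map_sup' := map_sup f.toCompleteLatticeHom
    map_inf' := map_inf f.toCompleteLatticeHom
    map_top' := map_top f.toCompleteLatticeHom
    map_bot' := map_bot f.toCompleteLatticeHom
    map_dia' := f.map_dia' } : ModalHom _ _)

/-- The category `MA_f`: the full subcategory of `MA` on the finite modal algebras. -/
abbrev MAf : Type (u + 1) := ObjectProperty.FullSubcategory (fun A : MA.{u} => Finite A)

instance MAf.instFinite (A : MAf.{u}) : Finite A.obj := A.property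

/-! ### The pro-completion -/

/-- The pro-completion `Pro-C = (Ind-(Cᵒᵖ))ᵒᵖ`. -/
abbrev Pro (C : Type w) [Category.{u} C] : Type (max w (u + 1)) := (Ind Cᵒᵖ)ᵒᵖ

/-- The covariant functor `C ⥤ Type`, a filtered colimit of corepresentable functors,
which a pro-object is by definition; its value at `c` is the set of morphisms
from the pro-object to `c`. -/
noncomputable def Pro.functor {C : Type w} [Category.{u} C] (P : Pro C) : C ⥤ Type u :=
  opOp C ⋙ (Ind.inclusion Cᵒᵖ).obj P.unop

/-- The transformation which a morphism of pro-objects is by definition (contravariantly). -/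
noncomputable def Pro.trans {C : Type w} [Category.{u} C] {P Q : Pro C} (f : P ⟶ Q) :
    Q.functor ⟶ P.functor :=
  Functor.whiskerLeft (opOp C) ((Ind.inclusion Cᵒᵖ).map f.unop)

theorem Pro.trans_id {C : Type w} [Category.{u} C] (P : Pro C) :
    Pro.trans (𝟙 P) = 𝟙 P.functor := by
  simp [trans, functor]

theorem Pro.trans_comp {C : Type w} [Category.{u} C] {P Q R : Pro C} (f : P ⟶ Q) (g : Q ⟶ R) :
    Pro.trans (f ≫ g) = Pro.trans g ≫ Pro.trans f := by
  simp [trans, functor]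

/-- For `F : MA_f ⥤ Type`, the limit of the underlying sets of the finite modal algebras `A`
over the category of elements `(A, x ∈ F A)` of `F`, as the set of compatible families. -/
structure ProLim (F : MAf.{u} ⥤ Type u) : Type (u + 1) where
  /-- The component at `(A, x)`. -/
  val : ∀ p : (Σ A : MAf.{u}, F.obj A), p.1.obj
  compat : ∀ {A B : MAf.{u}} (f : A ⟶ B) (x : F.obj A),
    val ⟨B, F.map f x⟩ = f.hom (val ⟨A, x⟩)

/-! In a finite algebra all joins are finite, so operators preserving finite joins
preserve all of them. -/

theorem Finite.map_sSup_of_supBot {α β : Type u} [CompleteLattice α] [CompleteLattice β] [Finite α]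
    (f : α → β) (hs : ∀ a b, f (a ⊔ b) = f a ⊔ f b) (hb : f ⊥ = ⊥) (s : Set α) :
    f (sSup s) = sSup (f '' s) := by
  induction s, s.toFinite using Set.Finite.induction_on with
  | empty => simpa using hb
  | insert _ _ ih => rw [sSup_insert, hs, ih, Set.image_insert_eq, sSup_insert]

theorem Finite.map_sInf_of_infTop {α β : Type u} [CompleteLattice α] [CompleteLattice β] [Finite α]
    (f : α → β) (hs : ∀ a b, f (a ⊓ b) = f a ⊓ f b) (hb : f ⊤ = ⊤) (s : Set α) :
    f (sInf s) = sInf (f '' s) := by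
  induction s, s.toFinite using Set.Finite.induction_on with
  | empty => simpa using hb
  | insert _ _ ih => rw [sInf_insert, hs, ih, Set.image_insert_eq, sInf_insert]

/-- A finite modal algebra lies in `CAMA∞`. -/
noncomputable abbrev ModalAlgebra.toComplete (α : Type u) [ModalAlgebra α] [Finite α] :
    CompleteModalAlgebra α :=
  letI := Fintype.ofFinite α
  letI := Fintype.toCompleteAtomicBooleanAlgebra α
  { ‹ModalAlgebra α›, Fintype.toCompleteAtomicBooleanAlgebra α with
    dia_sSup := Finite.map_sSup_of_supBot ModalAlgebra.dia ModalAlgebra.dia_sup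
      ModalAlgebra.dia_bot }

/-- The algebra structure transported along a bijection. -/
abbrev CompleteModalAlgebra.ofEquiv {α : Type u} {β : Type w} [CompleteModalAlgebra β]
    (e : α ≃ β) : CompleteModalAlgebra α :=
  letI := e.completeAtomicBooleanAlgebra
  have hsup (a b : α) : e (a ⊔ b) = e a ⊔ e b := e.apply_symm_apply _
  have hbot : e ⊥ = ⊥ := e.apply_symm_apply _
  have hsSup (s : Set α) : e (sSup s) = sSup (e '' s) :=
    (e.apply_symm_apply _).trans sSup_image.symm
  { dia := fun a => e.symm (ModalAlgebra.dia (e a))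
    dia_sup := fun a b => e.injective (by simp [hsup, ModalAlgebra.dia_sup])
    dia_bot := e.injective (by simp [hbot, ModalAlgebra.dia_bot])
    dia_sSup := fun s => e.injective (by
      rw [e.apply_symm_apply, hsSup, hsSup]
      exact (CompleteModalAlgebra.dia_sSup (e '' s)).trans (by
        rw [Set.image_image, Set.image_image]
        simp only [e.apply_symm_apply]
        rfl)) }

namespace ProLim

attribute [local instance] ModalAlgebra.toComplete

variable {F G : MAf.{u} ⥤ Type u}

theorem val_injective : Function.Injective (val : ProLim F → _) := by
  rintro ⟨s, _⟩ ⟨t, _⟩ h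
  congr

theorem map_sSup {A B : MAf.{u}} (f : A ⟶ B) (s : Set A.obj) :
    f.hom (sSup s) = sSup (f.hom '' s) :=
  Finite.map_sSup_of_supBot _ (map_sup (F := ModalHom A.obj B.obj) f.hom)
    (map_bot (F := ModalHom A.obj B.obj) f.hom) s

theorem map_sInf {A B : MAf.{u}} (f : A ⟶ B) (s : Set A.obj) :
    f.hom (sInf s) = sInf (f.hom '' s) :=
  Finite.map_sInf_of_infTop _ (map_inf (F := ModalHom A.obj B.obj) f.hom)
    (map_top (F := ModalHom A.obj B.obj) f.hom) s

theorem map_compl {A B : MAf.{u}} (f : A ⟶ B) (a : A.obj) : f.hom aᶜ = (f.hom a)ᶜ :=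
  map_compl' (F := ModalHom A.obj B.obj) f.hom a

/-! The operations on compatible families are componentwise. -/

noncomputable instance instMax : Max (ProLim F) where
  max s t := ⟨s.val ⊔ t.val, fun f x => by
    simp only [Pi.sup_apply, s.compat, t.compat]
    exact (map_sup (F := ModalHom _ _) f.hom _ _).symm⟩

noncomputable instance instMin : Min (ProLim F) where
  min s t := ⟨s.val ⊓ t.val, fun f x => by
    simp only [Pi.inf_apply, s.compat, t.compat]
    exact (map_inf (F := ModalHom _ _) f.hom _ _).symm⟩

instance instTop : Top (ProLim F) where
  top := ⟨⊤, fun f _ => (map_top (F := ModalHom _ _) f.hom).symm⟩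

instance instBot : Bot (ProLim F) where
  bot := ⟨⊥, fun f _ => (map_bot (F := ModalHom _ _) f.hom).symm⟩

instance instCompl : Compl (ProLim F) where
  compl s := ⟨s.valᶜ, fun f x => by
    simp only [Pi.compl_apply, s.compat]
    exact (map_compl f _).symm⟩

noncomputable instance instSupSet : SupSet (ProLim F) where
  sSup S := ⟨sSup (val '' S), fun f x => by
    simp only [sSup_apply_eq_sSup_image, map_sSup, Set.image_image, compat]⟩

noncomputable instance instInfSet : InfSet (ProLim F) where
  sInf S := ⟨sInf (val '' S), fun f x => by
    simp only [sInf_apply_eq_sInf_image, map_sInf, Set.image_image, compat]⟩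

instance instLE : LE (ProLim F) := ⟨fun s t => s.val ≤ t.val⟩

instance instLT : LT (ProLim F) := ⟨fun s t => s.val < t.val⟩

noncomputable instance instSDiff : SDiff (ProLim F) := ⟨fun s t => s ⊓ tᶜ⟩

noncomputable instance instHImp : HImp (ProLim F) := ⟨fun s t => t ⊔ sᶜ⟩

noncomputable instance instHNot : HNot (ProLim F) := ⟨fun s => sᶜ⟩

noncomputable instance instCompleteModalAlgebra : CompleteModalAlgebra (ProLim F) :=
  { val_injective.completeAtomicBooleanAlgebra val Iff.rfl Iff.rfl
      (fun _ _ => rfl) (fun _ _ => rfl) (fun _ => sSup_image) (fun _ => sInf_image)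
      rfl rfl (fun _ => rfl) (fun _ _ => himp_eq.symm) (fun _ => hnot_eq_compl.symm)
      (fun _ _ => sdiff_eq.symm) with
    dia := fun s => ⟨fun p => ModalAlgebra.dia (s.val p), fun f x => by
      rw [s.compat]
      exact (f.hom.map_dia' _).symm⟩
    dia_sup := fun s t => val_injective (funext fun _ => ModalAlgebra.dia_sup _ _)
    dia_bot := val_injective (funext fun _ => ModalAlgebra.dia_bot)
    dia_sSup := fun S => val_injective (funext fun p => by
      change ModalAlgebra.dia (sSup (val '' S) p) = sSup (val '' _) p
      rw [sSup_apply_eq_sSup_image, sSup_apply_eq_sSup_image]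
      refine (CompleteModalAlgebra.dia_sSup _).trans ?_
      simp only [Set.image_image]
      rfl) }

/-- Restriction of compatible families along a natural transformation. -/
noncomputable def map (η : G ⟶ F) : CompleteModalHom (ProLim F) (ProLim G) where
  toFun s := ⟨fun p => s.val ⟨p.1, η.app p.1 p.2⟩, fun {_ B} f x => by
    rw [← s.compat]
    have h (y z : F.obj B) (hyz : y = z) : @Eq B.obj (s.val ⟨B, y⟩) (s.val ⟨B, z⟩) := by rw [hyz]
    exact h _ _ (ConcreteCategory.congr_hom (η.naturality f) x)⟩
  map_sInf' S := val_injective (funext fun p => by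
    change sInf (val '' S) (⟨p.1, η.app p.1 p.2⟩ : Σ A : MAf.{u}, F.obj A) = sInf (val '' _) p
    simp only [sInf_apply_eq_sInf_image, Set.image_image])
  map_sSup' S := val_injective (funext fun p => by
    change sSup (val '' S) (⟨p.1, η.app p.1 p.2⟩ : Σ A : MAf.{u}, F.obj A) = sSup (val '' _) p
    simp only [sSup_apply_eq_sSup_image, Set.image_image])
  map_dia' _ := rfl

end ProLim

/-- The limit is small, since a pro-object is a small cofiltered limit of objects of `MA_f`. -/
theorem Pro.small_proLim (P : Pro MAf.{u}) : Small.{u} (ProLim P.functor) := by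
  obtain ⟨⟨D⟩⟩ := P.unop.isIndObject_inclusion_obj
  let e (i : D.I) : P.functor.obj (D.F.obj i).unop := (D.ι.app i).app (op (D.F.obj i)) (𝟙 _)
  refine small_of_injective (β := ∀ i : D.I, (D.F.obj i).unop.obj)
    (f := fun s i => s.val ⟨(D.F.obj i).unop, e i⟩) fun s t h => ?_
  refine ProLim.val_injective (funext fun ⟨A, x⟩ => ?_)
  obtain ⟨i, y, hy⟩ := Types.jointly_surjective_of_isColimit
    (isColimitOfPreserves ((evaluation _ _).obj (op (op A))) D.isColimit) x
  let g : (D.F.obj i).unop ⟶ A := Quiver.Hom.unop y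
  have hx : P.functor.map g (e i) = x := by
    rw [← hy]
    have := ConcreteCategory.congr_hom ((D.ι.app i).naturality g.op.op) (𝟙 (D.F.obj i))
    refine this.symm.trans ?_
    change (D.ι.app i).app _ (g.op ≫ 𝟙 _) = (D.ι.app i).app _ y
    rw [Category.comp_id]
    rfl
  rw [← hx, s.compat, t.compat]
  exact congrArg g.hom (congrFun h i)

/-- A morphism transported along bijections. -/
def CompleteModalHom.ofEquiv {α β : Type u} {γ δ : Type w} [CompleteModalAlgebra γ]
    [CompleteModalAlgebra δ] (e : α ≃ γ) (d : β ≃ δ) (f : CompleteModalHom γ δ) :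
    letI := CompleteModalAlgebra.ofEquiv e
    letI := CompleteModalAlgebra.ofEquiv d
    CompleteModalHom α β :=
  letI := CompleteModalAlgebra.ofEquiv e
  letI := CompleteModalAlgebra.ofEquiv d
  { toFun := fun a => d.symm (f (e a))
    map_sInf' := fun s => d.injective (by
      refine (d.apply_symm_apply _).trans ?_
      refine (congrArg f (e.apply_symm_apply _)).trans ?_
      refine Eq.trans ?_ (d.apply_symm_apply _).symm
      refine (congrArg f sInf_image.symm).trans ((f.map_sInf' _).trans ?_)
      rw [← sInf_image, Set.image_image, Set.image_image]
      simp only [d.apply_symm_apply]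
      rfl)
    map_sSup' := fun s => d.injective (by
      refine (d.apply_symm_apply _).trans ?_
      refine (congrArg f (e.apply_symm_apply _)).trans ?_
      refine Eq.trans ?_ (d.apply_symm_apply _).symm
      refine (congrArg f sSup_image.symm).trans ((f.map_sSup' _).trans ?_)
      rw [← sSup_image, Set.image_image, Set.image_image]
      simp only [d.apply_symm_apply]
      rfl)
    map_dia' := fun a => congrArg d.symm (by
      refine (congrArg f (e.apply_symm_apply _)).trans ((f.map_dia' _).trans ?_)
      exact congrArg ModalAlgebra.dia (d.apply_symm_apply _).symm) }

namespace Pro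

instance instSmall (P : Pro MAf.{u}) : Small.{u} (ProLim P.functor) := P.small_proLim

/-- The algebra of a pro-object, in `Type u`. -/
noncomputable instance instShrink (P : Pro MAf.{u}) :
    CompleteModalAlgebra (Shrink.{u} (ProLim P.functor)) :=
  CompleteModalAlgebra.ofEquiv (equivShrink _).symm

/-- The inclusion `Pro-MA_f ↪ CAMA∞`. It sends a formal cofiltered limit of finite modal algebras
to their actual limit: a pro-object `P` is sent to the limit of the finite modal algebras `A`
over all morphisms `P ⟶ A` of pro-objects. -/
noncomputable def toCAMA : Pro MAf.{u} ⥤ CAMA.{u} where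
  obj P := ⟨Shrink.{u} (ProLim P.functor)⟩
  map f := CompleteModalHom.ofEquiv (equivShrink _).symm (equivShrink _).symm (ProLim.map (trans f))
  map_id P := by
    refine CompleteModalHom.ext (funext fun s => ?_)
    refine (congrArg (equivShrink _) ?_).trans ((equivShrink _).apply_symm_apply s)
    rw [trans_id]
    rfl
  map_comp f g := by
    refine CompleteModalHom.ext (funext fun s => ?_)
    refine congrArg (equivShrink _) ?_
    rw [trans_comp]
    exact congrArg (ProLim.map (trans g)) ((equivShrink _).symm_apply_apply
      (ProLim.map (trans f) ((equivShrink _).symm s))).symm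

/-- The inclusion `ι : Pro-MA_f ↪ MA`, composed of the inclusions
`Pro-MA_f ↪ CAMA∞` and `CAMA∞ ↪ MA`. -/
noncomputable def toMA : Pro MAf.{u} ⥤ MA.{u} := toCAMA ⋙ CAMA.toMA

end Pro

/-! A pro-object is a functor `F` from `MAf` to sets whose category of elements is cofiltered, and
its algebra is the limit of a cofiltered system of finite nonempty sets. Compactness makes the image
of each projection equal to the image of a single transition map (`ProLim.exists_range_subset`). Two
consequences give full faithfulness. Distinct elements of `F.obj A` have distinct projections
(`ProLim.eq_of_val_eq`). Every complete morphism from the limit to a finite `A` is a projection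
(`ProLim.exists_eq_val`): the kernels of the projections are principal ideals whose generators form
a downward directed family with meet `⊥`, so, `A` being finite, the morphism kills one of these
generators. It then factors through the image of that projection, hence through a finite stage.

For the adjoint, finite modal algebras are closed under finite limits and essentially small, so
`Hom(B, -)` restricted to them is itself a pro-object (`MA.isIndObject_homPresheaf`). A morphism
from `B` to the limit is a compatible family of morphisms to finite algebras, that is, a
transformation `P.functor ⟶ B.homFunctor` (`MA.liftEquiv`), which is a morphism of pro-objects in
the opposite direction. -/

/-! ### Limits of finite modal algebras over cofiltered categories of elements -/

namespace ProLim

variable {F : MAf.{u} ⥤ Type u}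

/-- The inverse system of finite sets underlying `ProLim F`. -/
def diagram (F : MAf.{u} ⥤ Type u) : F.Elements ⥤ Type u where
  obj p := p.1.obj
  map f := ↾(fun a => f.1.hom a)

instance diagram_finite (p : F.Elements) : Finite ((diagram F).obj p) :=
  MAf.instFinite p.1

instance diagram_nonempty (p : F.Elements) : Nonempty ((diagram F).obj p) :=
  ⟨(⊥ : p.1.obj)⟩

/-- Sections of the inverse system are compatible families. -/
def ofSection (s : (diagram F).sections) : ProLim F where
  val p := s.1 p
  compat {A B} f x := (s.2 (CategoryOfElements.homMk (F := F) ⟨A, x⟩ ⟨B, F.map f x⟩ f rfl)).symm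

theorem val_hom (s : ProLim F) {p q : F.Elements} (f : p ⟶ q) :
    s.val q = f.1.hom (s.val p) := by
  obtain ⟨A, x⟩ := p
  obtain ⟨B, y⟩ := q
  -- The equation is separated from `f` so that `subst` can eliminate `y`.
  have h (g : A ⟶ B) (hg : F.map g x = y) : s.val ⟨B, y⟩ = g.hom (s.val ⟨A, x⟩) := by
    subst hg
    exact s.compat g x
  exact h f.1 f.2

/-- By compactness, the image of a projection is the image of a transition map. -/
theorem exists_range_subset [IsCofiltered F.Elements] (p : F.Elements) :
    ∃ (q : F.Elements) (f : q ⟶ p), ∀ b : q.1.obj, ∃ s : ProLim F, s.val p = f.1.hom b := by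
  have hML : (diagram F).IsMittagLeffler :=
    (diagram F).isMittagLeffler_of_exists_finite_range fun j =>
      ⟨j, 𝟙 j, Set.toFinite (α := (diagram F).obj j) _⟩
  -- The elements of the `p`-component that survive along all transition maps are already those in
  -- the range of one map `f`.
  obtain ⟨q, f, hf⟩ := (diagram F).isMittagLeffler_iff_eventualRange.1 hML p
  refine ⟨q, f, fun b => ?_⟩
  have hb : (diagram F).map f b ∈ (diagram F).eventualRange p := hf ▸ ⟨b, rfl⟩
  have : ∀ j, Nonempty ((diagram F).toEventualRanges.obj j) :=
    (diagram F).toEventualRanges_nonempty hML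
  -- The eventual ranges form a system of finite nonempty sets with surjective transition maps, so a
  -- surviving element extends to a global section.
  obtain ⟨s, hs⟩ := (diagram F).toEventualRanges.eval_section_surjective_of_surjective
    ((diagram F).surjective_toEventualRanges hML) p ⟨_, hb⟩
  exact ⟨ofSection ((diagram F).toEventualRangesSectionsEquiv s), congrArg Subtype.val hs⟩

/-- An element of `F.obj A` is determined by its projection. -/
theorem eq_of_val_eq [IsCofiltered F.Elements] {A : MAf.{u}} {y z : F.obj A}
    (h : ∀ s : ProLim F, @Eq A.obj (s.val ⟨A, y⟩) (s.val ⟨A, z⟩)) : y = z := by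
  obtain ⟨e, f, g, -⟩ := IsCofilteredOrEmpty.cone_objs (C := F.Elements) ⟨A, y⟩ ⟨A, z⟩
  obtain ⟨q, k, hk⟩ := exists_range_subset e
  -- Every value of `k` is a coordinate of a global family, and on such coordinates `f` and `g`
  -- agree by hypothesis.
  have hfg : k.1 ≫ f.1 = k.1 ≫ g.1 := by
    refine ObjectProperty.hom_ext _ (ModalHom.ext (funext fun b => ?_))
    obtain ⟨s, hs⟩ := hk b
    change f.1.hom (k.1.hom b) = g.1.hom (k.1.hom b)
    rw [← hs]
    exact (val_hom s f).symm.trans ((h s).trans (val_hom s g))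
  have hy : F.map (k.1 ≫ f.1) q.2 = y := (k ≫ f).2
  have hz : F.map (k.1 ≫ g.1) q.2 = z := (k ≫ g).2
  rw [← hy, ← hz, hfg]

/-! ### Kernels of projections, and complete morphisms to finite algebras. -/

section

attribute [local instance] ModalAlgebra.toComplete

/-- `IsGLB` needs only the order on the finite algebra, so the statement stays usable where its
complete structure is not a local instance. -/
theorem isGLB_val (S : Set (ProLim F)) (p : Σ A : MAf.{u}, F.obj A) :
    IsGLB ((fun s : ProLim F => s.val p) '' S) ((sInf S).val p) := by
  have h : (sInf S).val p = sInf ((fun s : ProLim F => s.val p) '' S) := by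
    change sInf (val '' S) p = _
    rw [sInf_apply_eq_sInf_image, Set.image_image]
  rw [h]
  exact isGLB_sInf _

/-- The largest family vanishing at `p`. -/
noncomputable def maxKernel (p : Σ A : MAf.{u}, F.obj A) : ProLim F := sSup {d | d.val p = ⊥}

/-- Joins are componentwise, so the kernel of a projection is closed under arbitrary joins and is
therefore principal. -/
theorem maxKernel_val (p : Σ A : MAf.{u}, F.obj A) : (maxKernel p).val p = ⊥ := by
  change sSup (val '' {d : ProLim F | d.val p = ⊥}) p = ⊥
  rw [sSup_apply_eq_sSup_image]
  refine sSup_eq_bot.2 ?_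
  rintro _ ⟨_, ⟨d, hd, rfl⟩, rfl⟩
  exact hd

theorem le_maxKernel {p : F.Elements} {d : ProLim F} (h : d.val p = ⊥) : d ≤ maxKernel p :=
  le_sSup h

/-- A family below every `maxKernel p` vanishes at every index. -/
theorem isGLB_maxKernel : IsGLB (Set.range (maxKernel (F := F))) ⊥ := by
  refine ⟨fun _ _ => bot_le, fun d hd => ?_⟩
  intro p
  exact (hd ⟨p, rfl⟩ p).trans (maxKernel_val p).le

end

/-- The kernel of a map to a finite algebra preserving finite joins and cofiltered meets contains
the kernel of some projection. -/
theorem exists_ker_le [IsCofiltered F.Elements] {A : MAf.{u}} (φ : ProLim F → A.obj)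
    (hsup : ∀ a b, φ (a ⊔ b) = φ a ⊔ φ b)
    (hglb : ∀ S : Set (ProLim F), IsGLB S ⊥ → IsGLB (φ '' S) ⊥) :
    ∃ p : F.Elements, ∀ d : ProLim F, d.val p = ⊥ → φ d = ⊥ := by
  have hmono : Monotone φ := fun a b hab => by
    rw [← sup_eq_right.2 hab, hsup]
    exact le_sup_left
  obtain ⟨p₀⟩ : Nonempty F.Elements := IsCofiltered.nonempty
  -- Finiteness of `A` gives a minimal value. Since the indices are cofiltered, a minimal value is
  -- the least one, so it lies below the meet `⊥`.
  obtain ⟨_, ⟨p, rfl⟩, hp⟩ :=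
    (Set.toFinite (Set.range fun p : F.Elements => φ (maxKernel p))).exists_minimal
    ⟨_, p₀, rfl⟩
  have hbot : φ (maxKernel p) ≤ ⊥ := by
    refine (hglb _ isGLB_maxKernel).2 ?_
    rintro _ ⟨_, ⟨q, rfl⟩, rfl⟩
    obtain ⟨r, f, g, -⟩ := IsCofilteredOrEmpty.cone_objs p q
    have hle {q : F.Elements} (f : r ⟶ q) : maxKernel r ≤ maxKernel q :=
      le_maxKernel ((val_hom _ f).trans
        ((congrArg f.1.hom (maxKernel_val r)).trans (map_bot (F := ModalHom _ _) f.1.hom)))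
    exact (hp ⟨r, rfl⟩ (hmono (hle f))).trans (hmono (hle g))
  exact ⟨p, fun d hd => le_bot_iff.1 ((hmono (le_maxKernel hd)).trans hbot)⟩

/-- A morphism to a finite modal algebra preserving infinite meets is a projection. -/
theorem exists_eq_val [IsCofiltered F.Elements] {A : MAf.{u}} (φ : ProLim F → A.obj)
    (hsup : ∀ a b, φ (a ⊔ b) = φ a ⊔ φ b) (hinf : ∀ a b, φ (a ⊓ b) = φ a ⊓ φ b)
    (htop : φ ⊤ = ⊤) (hbot : φ ⊥ = ⊥)
    (hdia : ∀ a, φ (ModalAlgebra.dia a) = ModalAlgebra.dia (φ a))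
    (hglb : ∀ S : Set (ProLim F), IsGLB S ⊥ → IsGLB (φ '' S) ⊥) :
    ∃ y : F.obj A, ∀ s, φ s = s.val ⟨A, y⟩ := by
  obtain ⟨p, hp⟩ := exists_ker_le φ hsup hglb
  -- Boolean complements turn the kernel condition into dependence on the `p`-coordinate alone.
  have hle (a b : ProLim F) (h : a.val p = b.val p) : φ a ≤ φ b := by
    have h0 : φ (a ⊓ bᶜ) = ⊥ := hp _ (by
      change a.val p ⊓ (b.val p)ᶜ = ⊥
      rw [h, inf_compl_eq_bot])
    have h1 : φ a = φ (a ⊓ b) := by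
      conv_lhs => rw [← sup_inf_inf_compl (x := a) (y := b), hsup, h0, sup_bot_eq]
    rw [h1, hinf]
    exact inf_le_right
  have heq (a b : ProLim F) (h : a.val p = b.val p) : φ a = φ b :=
    le_antisymm (hle a b h) (hle b a h.symm)
  obtain ⟨q, f, hf⟩ := exists_range_subset p
  -- The choice `c` need not be a morphism, but `φ ∘ c` is one: both sides of each law come from
  -- families with the same `p`-coordinate.
  choose c hc using hf
  let k : ModalHom q.1.obj A.obj :=
    { toFun := fun b => φ (c b)
      map_sup' := fun a b => by
        rw [← hsup]
        refine heq _ _ ?_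
        change _ = (c a).val p ⊔ (c b).val p
        rw [hc, hc, hc]
        exact map_sup (F := ModalHom _ _) f.1.hom a b
      map_inf' := fun a b => by
        rw [← hinf]
        refine heq _ _ ?_
        change _ = (c a).val p ⊓ (c b).val p
        rw [hc, hc, hc]
        exact map_inf (F := ModalHom _ _) f.1.hom a b
      map_top' := by
        rw [← htop]
        refine heq _ _ ?_
        rw [hc]
        exact map_top (F := ModalHom _ _) f.1.hom
      map_bot' := by
        rw [← hbot]
        refine heq _ _ ?_
        rw [hc]
        exact map_bot (F := ModalHom _ _) f.1.hom
      map_dia' := fun a => by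
        rw [← hdia]
        refine heq _ _ ?_
        change _ = ModalAlgebra.dia ((c a).val p)
        rw [hc, hc]
        exact f.1.hom.map_dia' a }
  refine ⟨F.map (ObjectProperty.homMk k) q.2, fun s => ?_⟩
  rw [s.compat]
  refine heq _ _ ?_
  rw [hc]
  exact val_hom s f

end ProLim

/-! ### Morphisms of pro-objects -/

namespace Pro

section

variable {C : Type w} [Category.{u} C]

/-- Precomposition with the equivalence `opOp C` induces an equivalence of categories of elements.
-/
theorem isCofiltered_elements_opOp_iff (G : Cᵒᵖᵒᵖ ⥤ Type u) :
    IsCofiltered (opOp C ⋙ G).Elements ↔ IsCofiltered G.Elements := by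
  let E := Functor.Elements.precomp (opOp C) G
  have : E.Full := ⟨fun {X Y} f => ⟨⟨f.1.unop.unop, f.2⟩, rfl⟩⟩
  have : E.Faithful := ⟨fun {X Y f g} h => Subtype.ext
    ((opOp C).map_injective (congrArg Subtype.val h))⟩
  have : E.EssSurj := ⟨fun Y => ⟨⟨Y.1.unop.unop, Y.2⟩, ⟨Iso.refl _⟩⟩⟩
  have : E.IsEquivalence := {}
  exact IsCofiltered.iff_of_equivalence E.asEquivalence

/-- For an ind-object, the category of representables over it is filtered, and this category is the
opposite of the category of elements. -/
instance isCofiltered_elements (P : Pro C) : IsCofiltered P.functor.Elements := by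
  refine (isCofiltered_elements_opOp_iff _).2 ?_
  have := P.unop.isIndObject_inclusion_obj.isFiltered
  have : IsFiltered ((Ind.inclusion Cᵒᵖ).obj P.unop).Elementsᵒᵖ :=
    .of_equivalence (CategoryOfElements.costructuredArrowYonedaEquivalence _).symm
  exact isCofiltered_of_isFiltered_op _

/-- Morphisms of pro-objects are natural transformations in the opposite direction. -/
noncomputable def transEquiv (P Q : Pro C) : (P ⟶ Q) ≃ (Q.functor ⟶ P.functor) where
  toFun := trans
  invFun η := Quiver.Hom.op ((Ind.inclusion Cᵒᵖ).preimage
    { app := fun X => η.app X.unop.unop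
      naturality := fun _ _ f => η.naturality f.unop.unop })
  left_inv f := by
    refine Quiver.Hom.unop_inj ?_
    refine (Ind.inclusion Cᵒᵖ).map_injective ?_
    refine (Functor.map_preimage _ _).trans ?_
    rfl
  right_inv η := by
    refine (congrArg (Functor.whiskerLeft (opOp C)) (Functor.map_preimage _ _)).trans ?_
    rfl

/-- The pro-object of an ind-object. -/
noncomputable def ofIsIndObject (G : Cᵒᵖᵒᵖ ⥤ Type u) (h : IsIndObject G) : Pro C :=
  op ((Ind.equivalence Cᵒᵖ).inverse.obj ⟨G, h⟩)

/-- The functor of the pro-object of an ind-object. -/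
noncomputable def functorOfIsIndObject (G : Cᵒᵖᵒᵖ ⥤ Type u) (h : IsIndObject G) :
    (ofIsIndObject G h).functor ≅ opOp C ⋙ G :=
  Functor.isoWhiskerLeft (opOp C)
    ((ObjectProperty.ι _).mapIso ((Ind.equivalence Cᵒᵖ).counitIso.app ⟨G, h⟩))

end

/-! ### The algebra of a pro-object -/

/-- The compatible family of an element of the algebra of a pro-object. -/
noncomputable def family {P : Pro MAf.{u}} (s : toMA.obj P) : ProLim P.functor :=
  (equivShrink.{u} (ProLim P.functor)).symm s

/-- The element given by a compatible family. -/
noncomputable def ofFamily {P : Pro MAf.{u}} (s : ProLim P.functor) : toMA.obj P :=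
  equivShrink.{u} (ProLim P.functor) s

variable {P Q : Pro MAf.{u}}

theorem family_ofFamily (s : ProLim P.functor) : family (ofFamily s) = s :=
  (equivShrink _).symm_apply_apply s

theorem ofFamily_family (s : toMA.obj P) : ofFamily (family s) = s :=
  (equivShrink _).apply_symm_apply s

theorem family_injective : Function.Injective (family (P := P)) :=
  (equivShrink _).symm.injective

theorem family_sup (s t : toMA.obj P) : family (s ⊔ t) = family s ⊔ family t :=
  family_ofFamily _

theorem family_inf (s t : toMA.obj P) : family (s ⊓ t) = family s ⊓ family t :=
  family_ofFamily _

theorem family_top : family (⊤ : toMA.obj P) = ⊤ :=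
  family_ofFamily _

theorem family_bot : family (⊥ : toMA.obj P) = ⊥ :=
  family_ofFamily _

theorem family_dia (s : toMA.obj P) :
    family (ModalAlgebra.dia s) = ModalAlgebra.dia (family s) :=
  family_ofFamily _

theorem ofFamily_sup (s t : ProLim P.functor) : ofFamily (s ⊔ t) = ofFamily s ⊔ ofFamily t :=
  family_injective (by rw [family_sup]; simp only [family_ofFamily])

theorem ofFamily_inf (s t : ProLim P.functor) : ofFamily (s ⊓ t) = ofFamily s ⊓ ofFamily t :=
  family_injective (by rw [family_inf]; simp only [family_ofFamily])

theorem ofFamily_dia (s : ProLim P.functor) :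
    ofFamily (ModalAlgebra.dia s) = ModalAlgebra.dia (ofFamily s) :=
  family_injective (by rw [family_dia]; simp only [family_ofFamily])

/-- The projection of the algebra of `P` corresponding to a morphism `P ⟶ A`. -/
noncomputable def proj (P : Pro MAf.{u}) {A : MAf.{u}} (x : P.functor.obj A) :
    toMA.obj P ⟶ A.obj :=
  ({ toFun := fun s => (family s).val ⟨A, x⟩
     map_sup' := fun s t => by rw [family_sup]; rfl
     map_inf' := fun s t => by rw [family_inf]; rfl
     map_top' := by rw [family_top]; rfl
     map_bot' := by rw [family_bot]; rfl
     map_dia' := fun s => by rw [family_dia]; rfl } : ModalHom _ _)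

theorem proj_injective {A : MAf.{u}} {x y : P.functor.obj A} (h : proj P x = proj P y) : x = y :=
  ProLim.eq_of_val_eq fun s => by
    have := ConcreteCategory.congr_hom h (ofFamily s)
    change (family (ofFamily s)).val ⟨A, x⟩ = (family (ofFamily s)).val ⟨A, y⟩ at this
    rwa [family_ofFamily] at this

theorem proj_map {A B : MAf.{u}} (f : A ⟶ B) (x : P.functor.obj A) :
    proj P (P.functor.map f x) = proj P x ≫ f.hom :=
  ModalHom.ext (funext fun s => (family s).compat f x)

theorem hom_ext_proj {B : MA.{u}} {f g : B ⟶ toMA.obj P}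
    (h : ∀ (A : MAf.{u}) (x : P.functor.obj A), f ≫ proj P x = g ≫ proj P x) : f = g :=
  ModalHom.ext (funext fun b => family_injective (ProLim.val_injective
    (funext fun p => ConcreteCategory.congr_hom (h p.1 p.2) b)))

theorem toMA_map_proj (f : P ⟶ Q) {A : MAf.{u}} (x : Q.functor.obj A) :
    toMA.map f ≫ proj Q x = proj P ((trans f).app A x) :=
  ModalHom.ext (funext fun _ =>
    congrArg (fun t : ProLim Q.functor => t.val ⟨A, x⟩) (family_ofFamily _))

/-! ### Full faithfulness of the inclusion into `CAMA`. -/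

theorem family_sInf (S : Set (toCAMA.obj P)) :
    family (P := P) (sInf (α := toCAMA.obj P) S) = sInf (family (P := P) '' S) :=
  (family_ofFamily _).trans sInf_image.symm

/-- Finite modal algebras are finitely copresentable with respect to complete morphisms out of
algebras of pro-objects. -/
theorem exists_proj_eq (g : toCAMA.obj P ⟶ toCAMA.obj Q) {A : MAf.{u}} (x : Q.functor.obj A) :
    ∃ y : P.functor.obj A, proj P y = CAMA.toMA.map g ≫ proj Q x := by
  let φ : ModalHom (toMA.obj P) A.obj := CAMA.toMA.map g ≫ proj Q x
  obtain ⟨y, hy⟩ := ProLim.exists_eq_val (F := P.functor) (fun s => φ (ofFamily s))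
    (fun a b => (congrArg φ (ofFamily_sup a b)).trans (map_sup φ _ _))
    (fun a b => (congrArg φ (ofFamily_inf a b)).trans (map_inf φ _ _))
    (map_top φ) (map_bot φ)
    (fun a => (congrArg φ (ofFamily_dia a)).trans (φ.map_dia' (ofFamily a))) (fun S hS => by
      -- `ψ` is `g` read on families. It preserves the meet because `g` is complete, and the
      -- projection at `x` does because meets are componentwise.
      let ψ (s : ProLim P.functor) : ProLim Q.functor := family (P := Q) (g (ofFamily s))
      have h₀ : sInf (α := toCAMA.obj P) (ofFamily (P := P) '' S) = ⊥ := by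
        refine family_injective ?_
        refine (family_sInf _).trans ?_
        have h : family (P := P) '' (ofFamily '' S) = S := by
          rw [Set.image_image]
          simp only [family_ofFamily, Set.image_id']
        exact (congrArg sInf h).trans (hS.sInf_eq.trans family_bot.symm)
      have h₁ : sInf (ψ '' S) = ⊥ := by
        have h := (g.map_sInf' (ofFamily (P := P) '' S)).symm
        rw [h₀] at h
        replace h := congrArg (family (P := Q)) (h.trans (map_bot g.toCompleteLatticeHom))
        refine Eq.trans ?_ (h.trans family_bot)
        refine Eq.trans (congrArg sInf ?_) (family_sInf _).symm
        exact ((Set.image_image (family (P := Q)) g.toFun _).trans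
          (Set.image_image _ (ofFamily (P := P)) S)).symm
      have h₂ := ProLim.isGLB_val (ψ '' S) ⟨A, x⟩
      rw [h₁, Set.image_image] at h₂
      exact h₂)
  refine ⟨y, ModalHom.ext (funext fun s => ?_)⟩
  refine (hy (family s)).symm.trans ?_
  exact congrArg φ (ofFamily_family s)

/-- Every complete morphism is induced by a morphism of pro-objects. -/
theorem exists_toCAMA_map_eq (g : toCAMA.obj P ⟶ toCAMA.obj Q) :
    ∃ f : P ⟶ Q, toCAMA.map f = g := by
  choose y hy using fun (A : MAf.{u}) (x : Q.functor.obj A) => exists_proj_eq g x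
  let η : Q.functor ⟶ P.functor :=
    { app := fun A => ↾(y A)
      naturality := fun A B f => by
        ext x
        -- The choices `y` are forced, since an element is determined by its projection; this is
        -- what makes them natural.
        refine proj_injective ?_
        refine (hy _ _).trans ?_
        refine (congrArg _ (proj_map f x)).trans ?_
        refine Eq.trans ?_ (proj_map f (y A x)).symm
        rw [hy]
        rfl }
  refine ⟨(transEquiv P Q).symm η, ?_⟩
  have hη : trans ((transEquiv P Q).symm η) = η := (transEquiv P Q).apply_symm_apply η
  have h : toMA.map ((transEquiv P Q).symm η) = CAMA.toMA.map g := hom_ext_proj fun A x => by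
    refine (toMA_map_proj _ x).trans ?_
    rw [hη]
    exact hy A x
  exact CompleteModalHom.ext (funext fun s => ConcreteCategory.congr_hom h s)

instance toCAMA_full : toCAMA.{u}.Full := ⟨exists_toCAMA_map_eq⟩

/-- The induced map followed by the projection at `x` is the projection at `(trans f).app A x`,
which determines that element. -/
instance toCAMA_faithful : toCAMA.{u}.Faithful := ⟨fun {P Q f g} h => by
  refine (transEquiv P Q).injective ?_
  refine NatTrans.ext (funext fun A => ?_)
  ext x
  refine proj_injective ?_
  refine (toMA_map_proj f x).symm.trans (Eq.trans ?_ (toMA_map_proj g x))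
  exact congrArg (fun k => CAMA.toMA.map k ≫ proj Q x) h⟩

end Pro

/-! ### Finite limits of modal algebras -/

instance PUnit.instModalAlgebra : ModalAlgebra PUnit.{u + 1} where
  dia a := a
  dia_sup _ _ := rfl
  dia_bot := rfl

instance Prod.instModalAlgebra {α β : Type u} [ModalAlgebra α] [ModalAlgebra β] :
    ModalAlgebra (α × β) where
  dia a := (ModalAlgebra.dia a.1, ModalAlgebra.dia a.2)
  dia_sup a b := Prod.ext (ModalAlgebra.dia_sup a.1 b.1) (ModalAlgebra.dia_sup a.2 b.2)
  dia_bot := Prod.ext ModalAlgebra.dia_bot ModalAlgebra.dia_bot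

/-- The algebra structure transported along a bijection. -/
abbrev ModalAlgebra.ofEquiv {α : Type u} {β : Type w} [ModalAlgebra β] (e : α ≃ β) :
    ModalAlgebra α :=
  letI := e.booleanAlgebra
  have hsup (a b : α) : e (a ⊔ b) = e a ⊔ e b := e.apply_symm_apply _
  have hbot : e ⊥ = ⊥ := e.apply_symm_apply _
  { dia := fun a => e.symm (dia (e a))
    dia_sup := fun a b => e.injective (by simp [hsup, dia_sup])
    dia_bot := e.injective (by simp [hbot, dia_bot]) }

/-- A bijection is an isomorphism from the transported structure. -/
def ModalHom.ofEquiv {α β : Type u} [ModalAlgebra β] (e : α ≃ β) :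
    letI := ModalAlgebra.ofEquiv e
    ModalHom α β :=
  letI := ModalAlgebra.ofEquiv e
  { toFun := e
    map_sup' := fun _ _ => e.apply_symm_apply _
    map_inf' := fun _ _ => e.apply_symm_apply _
    map_top' := e.apply_symm_apply _
    map_bot' := e.apply_symm_apply _
    map_dia' := fun _ => e.apply_symm_apply _ }

/-- The inverse of a bijection is an isomorphism to the transported structure. -/
def ModalHom.ofEquivSymm {α β : Type u} [ModalAlgebra β] (e : α ≃ β) :
    letI := ModalAlgebra.ofEquiv e
    ModalHom β α :=
  letI := ModalAlgebra.ofEquiv e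
  { toFun := e.symm
    map_sup' := fun a b => congrArg e.symm
      (congrArg₂ (· ⊔ ·) (e.apply_symm_apply a) (e.apply_symm_apply b)).symm
    map_inf' := fun a b => congrArg e.symm
      (congrArg₂ (· ⊓ ·) (e.apply_symm_apply a) (e.apply_symm_apply b)).symm
    map_top' := rfl
    map_bot' := rfl
    map_dia' := fun a => congrArg (fun b => e.symm (ModalAlgebra.dia b))
      (e.apply_symm_apply a).symm }

namespace ModalHom

variable {α β γ : Type u} [ModalAlgebra α] [ModalAlgebra β] [ModalAlgebra γ]

/-- The first projection. -/
def fst : ModalHom (α × β) α where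
  toFun := Prod.fst
  map_sup' _ _ := rfl
  map_inf' _ _ := rfl
  map_top' := rfl
  map_bot' := rfl
  map_dia' _ := rfl

/-- The second projection. -/
def snd : ModalHom (α × β) β where
  toFun := Prod.snd
  map_sup' _ _ := rfl
  map_inf' _ _ := rfl
  map_top' := rfl
  map_bot' := rfl
  map_dia' _ := rfl

/-- The morphism into a product. -/
def prod (f : ModalHom γ α) (g : ModalHom γ β) : ModalHom γ (α × β) where
  toFun c := (f c, g c)
  map_sup' a b := Prod.ext (map_sup f a b) (map_sup g a b)
  map_inf' a b := Prod.ext (map_inf f a b) (map_inf g a b)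
  map_top' := Prod.ext (map_top f) (map_top g)
  map_bot' := Prod.ext (map_bot f) (map_bot g)
  map_dia' a := Prod.ext (f.map_dia' a) (g.map_dia' a)

/-- The morphism to the one-element algebra. -/
def toPUnit : ModalHom γ PUnit.{u + 1} where
  toFun _ := ⟨⟩
  map_sup' _ _ := rfl
  map_inf' _ _ := rfl
  map_top' := rfl
  map_bot' := rfl
  map_dia' _ := rfl

/-- The equalizer of two morphisms. -/
def Equalizer (f g : ModalHom α β) : Type u := {a : α // f a = g a}

variable (f g : ModalHom α β)

instance [Finite α] : Finite (Equalizer f g) := Subtype.finite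

instance : BooleanAlgebra (Equalizer f g) :=
  letI : Max (Equalizer f g) := ⟨fun a b => ⟨a.1 ⊔ b.1, by rw [map_sup, map_sup, a.2, b.2]⟩⟩
  letI : Min (Equalizer f g) := ⟨fun a b => ⟨a.1 ⊓ b.1, by rw [map_inf, map_inf, a.2, b.2]⟩⟩
  letI : Top (Equalizer f g) := ⟨⟨⊤, by rw [map_top, map_top]⟩⟩
  letI : Bot (Equalizer f g) := ⟨⟨⊥, by rw [map_bot, map_bot]⟩⟩
  letI : Compl (Equalizer f g) := ⟨fun a => ⟨a.1ᶜ, by rw [map_compl', map_compl', a.2]⟩⟩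
  letI : SDiff (Equalizer f g) := ⟨fun a b => a ⊓ bᶜ⟩
  letI : HImp (Equalizer f g) := ⟨fun a b => b ⊔ aᶜ⟩
  letI : LE (Equalizer f g) := ⟨fun a b => a.1 ≤ b.1⟩
  letI : LT (Equalizer f g) := ⟨fun a b => a.1 < b.1⟩
  Function.Injective.booleanAlgebra (Subtype.val : Equalizer f g → α) Subtype.val_injective
    Iff.rfl Iff.rfl (fun _ _ => rfl) (fun _ _ => rfl) rfl rfl (fun _ => rfl)
    (fun _ _ => sdiff_eq.symm) (fun _ _ => himp_eq.symm)

instance : ModalAlgebra (Equalizer f g) where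
  dia a := ⟨ModalAlgebra.dia a.1,
    (f.map_dia' a.1).trans ((congrArg ModalAlgebra.dia a.2).trans (g.map_dia' a.1).symm)⟩
  dia_sup a b := Subtype.ext (ModalAlgebra.dia_sup a.1 b.1)
  dia_bot := Subtype.ext ModalAlgebra.dia_bot

/-- The inclusion of the equalizer. -/
def equalizerVal : ModalHom (Equalizer f g) α where
  toFun := Subtype.val
  map_sup' _ _ := rfl
  map_inf' _ _ := rfl
  map_top' := rfl
  map_bot' := rfl
  map_dia' _ := rfl

/-- The morphism into the equalizer. -/
def equalizerLift (h : ModalHom γ α) (w : ∀ c, f (h c) = g (h c)) :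
    ModalHom γ (Equalizer f g) where
  toFun c := ⟨h c, w c⟩
  map_sup' a b := Subtype.ext (map_sup h a b)
  map_inf' a b := Subtype.ext (map_inf h a b)
  map_top' := Subtype.ext (map_top h)
  map_bot' := Subtype.ext (map_bot h)
  map_dia' a := Subtype.ext (h.map_dia' a)

end ModalHom

/-! ### The profinite completion -/

namespace MA

/-- The finite modal algebra with a given carrier. -/
abbrev ofFinite (α : Type u) [ModalAlgebra α] [Finite α] : MAf.{u} :=
  ⟨⟨α⟩, ‹Finite α›⟩

/-- The functor sending a finite modal algebra `A` to the set of morphisms `B ⟶ A`. -/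
def homFunctor (B : MA.{u}) : MAf.{u} ⥤ Type u where
  obj A := B ⟶ A.obj
  map f := ↾(fun g => g ≫ f.hom)

/-- An element of the value of `homFunctor`, as a morphism of algebras. -/
def toModalHom {B : MA.{u}} {A : MAf.{u}} (f : B.homFunctor.obj A) : ModalHom B A.obj := f

/-- The one-element algebra, binary products and equalizers stay finite, and morphisms from `B` lift
to them. -/
instance isCofiltered_elements (B : MA.{u}) : IsCofiltered B.homFunctor.Elements where
  nonempty := ⟨⟨ofFinite PUnit.{u + 1}, (ModalHom.toPUnit : ModalHom B _)⟩⟩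
  cone_objs := by
    rintro ⟨A, f⟩ ⟨A', f'⟩
    exact ⟨⟨ofFinite (A.obj × A'.obj), ModalHom.prod f f'⟩,
      CategoryOfElements.homMk _ _ (ObjectProperty.homMk ModalHom.fst) rfl,
      CategoryOfElements.homMk _ _ (ObjectProperty.homMk ModalHom.snd) rfl, trivial⟩
  cone_maps := by
    rintro ⟨A, f⟩ ⟨A', f'⟩ g h
    have w (b : B) : g.1.hom (toModalHom f b) = h.1.hom (toModalHom f b) :=
      ConcreteCategory.congr_hom (g.2.trans h.2.symm) b
    refine ⟨⟨ofFinite (ModalHom.Equalizer g.1.hom h.1.hom), ModalHom.equalizerLift _ _ f w⟩,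
      CategoryOfElements.homMk _ _ (ObjectProperty.homMk (ModalHom.equalizerVal _ _)) rfl, ?_⟩
    refine Subtype.ext (ObjectProperty.hom_ext _ (ModalHom.ext (funext fun a => ?_)))
    exact a.2

/-- The functor `homFunctor` as a presheaf on the opposite category. -/
def homPresheaf (B : MA.{u}) : MAf.{u}ᵒᵖᵒᵖ ⥤ Type u := unopUnop _ ⋙ B.homFunctor

/-- Besides filteredness, a small weakly terminal set is needed: each finite algebra is isomorphic
to one carried by some `Fin n`. -/
theorem isIndObject_homPresheaf (B : MA.{u}) : IsIndObject B.homPresheaf := by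
  let G := B.homPresheaf
  have : IsCofiltered G.Elements :=
    (Pro.isCofiltered_elements_opOp_iff G).1 B.isCofiltered_elements
  let E := CategoryOfElements.costructuredArrowYonedaEquivalence G
  have : IsFiltered (CostructuredArrow yoneda G) := .of_equivalence E
  let T : Type u := Σ (n : ℕ) (m : ModalAlgebra (ULift.{u} (Fin n))),
    ModalHom B (ULift.{u} (Fin n))
  let t (x : T) : CostructuredArrow yoneda G :=
    letI := x.2.1
    E.functor.obj (op ⟨op (op (ofFinite (ULift.{u} (Fin x.1)))), x.2.2⟩)
  have : FinallySmall.{u} (CostructuredArrow yoneda G) := by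
    refine finallySmall_of_small_weakly_terminal_set (Set.range t) fun X => ?_
    obtain ⟨⟨⟨A, f⟩⟩, ⟨i⟩⟩ : ∃ Y : G.Elementsᵒᵖ, Nonempty (E.functor.obj Y ≅ X) :=
      Functor.EssSurj.mem_essImage E.functor X
    obtain ⟨n, ⟨e⟩⟩ := Finite.exists_equiv_fin A.unop.unop.obj
    let d : ULift.{u} (Fin n) ≃ A.unop.unop.obj := Equiv.ulift.trans e.symm
    let _ := ModalAlgebra.ofEquiv d
    -- The structure of `A` is transported to `Fin n`, and `f` is carried along.
    let h : B ⟶ (ofFinite (ULift.{u} (Fin n))).obj :=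
      CategoryStruct.comp (obj := MA) (Y := A.unop.unop.obj) f (ModalHom.ofEquivSymm d)
    refine ⟨t ⟨n, inferInstance, h⟩, ⟨_, rfl⟩, ⟨i.inv ≫ E.functor.map (Quiver.Hom.op ?_)⟩⟩
    refine CategoryOfElements.homMk _ _
      (Quiver.Hom.op (Quiver.Hom.op (ObjectProperty.homMk (ModalHom.ofEquiv d)))) ?_
    refine ModalHom.ext (funext fun b => ?_)
    exact d.apply_symm_apply _
  exact isIndObject_of_isFiltered_of_finallySmall G

/-- The profinite completion of a modal algebra. -/
noncomputable def profiniteCompletion (B : MA.{u}) : Pro MAf.{u} :=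
  Pro.ofIsIndObject B.homPresheaf B.isIndObject_homPresheaf

/-- Morphisms from the profinite completion of `B` to `A` are morphisms `B ⟶ A`. -/
noncomputable def profiniteCompletionFunctor (B : MA.{u}) :
    B.profiniteCompletion.functor ≅ B.homFunctor :=
  Pro.functorOfIsIndObject B.homPresheaf B.isIndObject_homPresheaf

/-- Morphisms into the algebra of a pro-object are compatible families of morphisms. -/
noncomputable def liftEquiv (B : MA.{u}) (P : Pro MAf.{u}) :
    (P.functor ⟶ B.homFunctor) ≃ (B ⟶ Pro.toMA.obj P) where
  toFun η :=
    let s (b : B) : ProLim P.functor :=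
      { val := fun p => toModalHom (η.app p.1 p.2) b
        compat := fun f x => ConcreteCategory.congr_hom
          (ConcreteCategory.congr_hom (η.naturality f) x) b }
    ({ toFun := fun b => Pro.ofFamily (s b)
       map_sup' := fun a b => (congrArg Pro.ofFamily (ProLim.val_injective (funext fun p =>
         map_sup (toModalHom (η.app p.1 p.2)) a b))).trans (Pro.ofFamily_sup _ _)
       map_inf' := fun a b => (congrArg Pro.ofFamily (ProLim.val_injective (funext fun p =>
         map_inf (toModalHom (η.app p.1 p.2)) a b))).trans (Pro.ofFamily_inf _ _)
       map_top' := congrArg Pro.ofFamily (ProLim.val_injective (funext fun p =>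
         map_top (toModalHom (η.app p.1 p.2))))
       map_bot' := congrArg Pro.ofFamily (ProLim.val_injective (funext fun p =>
         map_bot (toModalHom (η.app p.1 p.2))))
       map_dia' := fun a => (congrArg Pro.ofFamily (ProLim.val_injective (funext fun p =>
         (toModalHom (η.app p.1 p.2)).map_dia' a))).trans
           (Pro.ofFamily_dia _) } : ModalHom _ _)
  invFun g :=
    { app := fun A => ↾(fun x => g ≫ Pro.proj P x)
      naturality := fun A A' f => by
        ext x
        exact congrArg (g ≫ ·) (Pro.proj_map f x) }
  left_inv η := by
    refine NatTrans.ext (funext fun A => ?_)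
    ext x
    exact ModalHom.ext (funext fun b =>
      congrArg (fun s : ProLim P.functor => s.val ⟨A, x⟩) (Pro.family_ofFamily _))
  right_inv g := Pro.hom_ext_proj fun A x => ModalHom.ext (funext fun b =>
    congrArg (fun s : ProLim P.functor => s.val ⟨A, x⟩) (Pro.family_ofFamily _))

theorem liftEquiv_proj {B : MA.{u}} {P : Pro MAf.{u}} (η : P.functor ⟶ B.homFunctor)
    {A : MAf.{u}} (x : P.functor.obj A) : B.liftEquiv P η ≫ Pro.proj P x = η.app A x :=
  ConcreteCategory.congr_hom
    (congrArg (fun θ : P.functor ⟶ B.homFunctor => θ.app A) ((B.liftEquiv P).symm_apply_apply η)) x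

/-- The universal property of the profinite completion. -/
noncomputable def profiniteCompletionHomEquiv (B : MA.{u}) (P : Pro MAf.{u}) :
    (B.profiniteCompletion ⟶ P) ≃ (B ⟶ Pro.toMA.obj P) :=
  ((Pro.transEquiv _ _).trans B.profiniteCompletionFunctor.homToEquiv).trans (B.liftEquiv P)

/-- Naturality in the pro-object suffices: the action of the left adjoint on morphisms is then
determined by the bijections. -/
theorem profiniteCompletionHomEquiv_comp (B : MA.{u}) (P Q : Pro MAf.{u}) (g : P ⟶ Q)
    (h : B.profiniteCompletion ⟶ P) :
    B.profiniteCompletionHomEquiv Q (h ≫ g) =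
      B.profiniteCompletionHomEquiv P h ≫ Pro.toMA.map g := by
  refine Pro.hom_ext_proj fun A x => ?_
  rw [Category.assoc, Pro.toMA_map_proj]
  refine (liftEquiv_proj _ x).trans (Eq.trans ?_ (liftEquiv_proj _ _).symm)
  change (Pro.trans (h ≫ g) ≫ _).app A x = _
  rw [Pro.trans_comp]
  rfl

end MA

theorem mainTheorem11 :
    Pro.toCAMA.{u}.Full ∧ Pro.toCAMA.{u}.Faithful ∧
      ∃ PrC : MA.{u} ⥤ Pro MAf.{u}, Nonempty (PrC ⊣ Pro.toMA.{u}) :=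
  ⟨inferInstance, inferInstance, _,
    ⟨Adjunction.adjunctionOfEquivLeft MA.profiniteCompletionHomEquiv
      MA.profiniteCompletionHomEquiv_comp⟩⟩
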